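/- Let $m,n,k$ be non-negative integers and let $F:[0,\infty)\to[0,\infty)$ be non-decreasing and a sparseness measure, i.e. $F(|x+y|)\le F(|x|)+F(|y|)$ for all $x,y\in\mathbb{R}$, and $F(x)=0$ if and only if $x=0$. For $\mathbf{x}\in\mathbb{R}^n$ put $J(\mathbf{x})=\sum_{i=1}^n F(|x_i|)$; call $\mathbf{x}$ $k$-sparse if it has at most $k$ non-zero entries; and let $\|\cdot\|$ denote the Euclidean norm. A matrix $\mathbf{A}\in\mathbb{R}^{m\times n}$ satisfies - the exact recovery condition (ERC) if for every $k$-sparse $\bar{\mathbf{x}}\in\mathbb{R}^n$, $\bar{\mathbf{x}}$ is the unique solution of the problem of minimizing $J(\mathbf{x})$ over $\mathbf{x}\in\mathbb{R}^n$ subject to $\mathbf{A}\mathbf{x}=\mathbf{A}\bar{\mathbf{x}}$; - the robust recovery condition (RRC) if there is a constant $C$ such that for every $k$-sparse $\bar{\mathbf{x}}\in\mathbb{R}^n$, every $\epsilon>0$, every $\mathbf{v}\in\mathbb{R}^m$ with $\|\mathbf{v}\|\le\epsilon$, and every $\hat{\mathbf{x}}\in\mathbb{R}^n$ with $\|\mathbf{A}\hat{\mathbf{x}}-(\mathbf{A}\bar{\mathbf{x}}+\mathbf{v})\|<\epsilon$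 and $J(\hat{\mathbf{x}})\le J(\bar{\mathbf{x}})$, we have $\|\bar{\mathbf{x}}-\hat{\mathbf{x}}\|<C\epsilon$. Let $\mathbf{A}$ be a random $m\times n$ real matrix whose distribution is absolutely continuous with respect to the Lebesgue measure on $\mathbb{R}^{m\times n}$. Then the events "$\mathbf{A}$ satisfies ERC" and "$\mathbf{A}$ satisfies RRC" are measurable with respect to the completion of the underlying probability measure, and they have the same probability. In particular, this holds when the entries of $\mathbf{A}$ are i.i.d. with a common distribution that is absolutely continuous with respect to the Lebesgue measure on $\mathbb{R}$. -/

import Mathlib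

open MeasureTheory ProbabilityTheory
open scoped NNReal

namespace FMin

/-- A sparseness measure: `F : [0,∞) → [0,∞)` such that `F(|·|)` is subadditive on `ℝ` and
`F` vanishes exactly at `0`. -/
structure IsSparsenessMeasure (F : ℝ≥0 → ℝ≥0) : Prop where
  subadditive : ∀ x y : ℝ, F (Real.nnabs (x + y)) ≤ F (Real.nnabs x) + F (Real.nnabs y)
  eq_zero_iff : ∀ x : ℝ≥0, F x = 0 ↔ x = 0

/-- The cost function `J(x) = ∑ i, F(|x i|)`. -/
def cost {n : ℕ} (F : ℝ≥0 → ℝ≥0) (x : EuclideanSpace ℝ (Fin n)) : ℝ≥0 :=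
  ∑ i, F (Real.nnabs (x i))

/-- `x` has at most `k` non-zero coordinates. -/
def IsSparse {n : ℕ} (k : ℕ) (x : EuclideanSpace ℝ (Fin n)) : Prop :=
  {i | x i ≠ 0}.ncard ≤ k

/-- `x` is a solution of the problem: minimize `J` subject to `A x = y`. -/
def IsSolution {m n : ℕ} (F : ℝ≥0 → ℝ≥0) (A : Matrix (Fin m) (Fin n) ℝ)
    (y : EuclideanSpace ℝ (Fin m)) (x : EuclideanSpace ℝ (Fin n)) : Prop :=
  A.toEuclideanLin x = y ∧
    ∀ x' : EuclideanSpace ℝ (Fin n), A.toEuclideanLin x' = y → cost F x ≤ cost F x'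

/-- Exact recovery condition: every `k`-sparse `xbar` is the unique solution of the
noiseless problem with measurement `y = A xbar`. -/
def ERC {m n : ℕ} (F : ℝ≥0 → ℝ≥0) (k : ℕ) (A : Matrix (Fin m) (Fin n) ℝ) : Prop :=
  ∀ xbar : EuclideanSpace ℝ (Fin n), IsSparse k xbar →
    ∀ x : EuclideanSpace ℝ (Fin n), IsSolution F A (A.toEuclideanLin xbar) x ↔ x = xbar

/-- Robust recovery condition: with a constant `C` depending only on `A`, `k`, `F`, every `xhat`
that is feasible for the noisy measurement `y = A xbar + v` at tolerance `ε ≥ ‖v‖` and costs no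
more than the `k`-sparse `xbar` lies within `C ε` of `xbar`. Norms are Euclidean. -/
def RRC {m n : ℕ} (F : ℝ≥0 → ℝ≥0) (k : ℕ) (A : Matrix (Fin m) (Fin n) ℝ) : Prop :=
  ∃ C : ℝ, ∀ (xbar xhat : EuclideanSpace ℝ (Fin n)) (v : EuclideanSpace ℝ (Fin m)) (ε : ℝ),
    0 < ε → IsSparse k xbar → ‖v‖ ≤ ε →
    ‖A.toEuclideanLin xhat - (A.toEuclideanLin xbar + v)‖ < ε →
    cost F xhat ≤ cost F xbar →
    ‖xbar - xhat‖ < C * ε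

/-- The space of real `m × n` matrices with its product (Borel) σ-algebra and Lebesgue measure,
the product over all entries of Lebesgue measure on `ℝ`. -/
noncomputable instance instMeasureSpaceMatrix (m n : ℕ) :
    MeasureSpace (Matrix (Fin m) (Fin n) ℝ) :=
  inferInstanceAs (MeasureSpace (Fin m → Fin n → ℝ))

/-- The events that `A` satisfies ERC and that `A` satisfies RRC both have a well-defined
probability (they are measurable for the completion of `P`), and these probabilities agree. -/
def SameProbability {Ω : Type*} [MeasurableSpace Ω] (P : Measure Ω) {m n : ℕ}
    (F : ℝ≥0 → ℝ≥0) (k : ℕ) (A : Ω → Matrix (Fin m) (Fin n) ℝ) : Prop :=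
  NullMeasurableSet {ω | ERC F k (A ω)} P ∧ NullMeasurableSet {ω | RRC F k (A ω)} P ∧
    P {ω | ERC F k (A ω)} = P {ω | RRC F k (A ω)}

end FMin

/-! ### Deterministic criteria: kernels and cones. -/

namespace FMin

/-! For each `S` with at most `k` elements, compare the kernel of `A` with the cone
`concentratedCone F S`. A non-zero kernel vector in the cone defeats both ERC and RRC
(`exists_competitor`). If the kernel avoids even the closed cone away from `0`, both hold;
compactness of the unit sphere supplies the constant for RRC. The two conditions can thus differ
only when the kernel meets the closed cone but not the cone itself, and it remains to show that such
matrices form a null set.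

Shrinking the columns in `S` and expanding the others is a linear flow. It preserves the closed set
`G` of matrices whose kernel meets the closed cone. The points of `G` that leave it at once under
the backward flow have pairwise disjoint translates, so they form a null set
(`volume_exit_eq_zero`). Any other point of `G` has a kernel vector strictly dominating a vector of
the closed cone where the latter is non-zero; general position allows its zero entries to be
corrected, which gives a kernel vector in the cone (`HasFullRankColumns.mem_kernelMeets`). -/

/-- The cone generated by the vectors whose cost on `S` is at least their cost off `S`. -/
def concentratedCone {n : ℕ} (F : ℝ≥0 → ℝ≥0) (S : Finset (Fin n)) :
    Set (EuclideanSpace ℝ (Fin n)) :=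
  {z | ∃ t : ℝ, 0 < t ∧
    ∑ i ∈ Sᶜ, F (Real.nnabs (t * z i)) ≤ ∑ i ∈ S, F (Real.nnabs (t * z i))}

/-- The matrices whose kernel meets the unit sphere in the closure of the cone. -/
def kernelMeetsClosure {n : ℕ} (m : ℕ) (F : ℝ≥0 → ℝ≥0) (S : Finset (Fin n)) :
    Set (Matrix (Fin m) (Fin n) ℝ) :=
  {A | ∃ z ∈ closure (concentratedCone F S), ‖z‖ = 1 ∧ A.toEuclideanLin z = 0}

/-- The matrices whose kernel contains a non-zero vector of the cone. -/
def kernelMeets {n : ℕ} (m : ℕ) (F : ℝ≥0 → ℝ≥0) (S : Finset (Fin n)) :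
    Set (Matrix (Fin m) (Fin n) ℝ) :=
  {A | ∃ z ∈ concentratedCone F S, z ≠ 0 ∧ A.toEuclideanLin z = 0}

variable {m n k : ℕ} {F : ℝ≥0 → ℝ≥0} {S : Finset (Fin n)}

lemma smul_mem_concentratedCone {z : EuclideanSpace ℝ (Fin n)} (hz : z ∈ concentratedCone F S)
    {c : ℝ} (hc : 0 < c) : c • z ∈ concentratedCone F S := by
  obtain ⟨t, ht, h⟩ := hz
  refine ⟨t / c, by positivity, ?_⟩
  have (i : Fin n) : t / c * (c • z) i = t * z i := by
    simp only [PiLp.smul_apply, smul_eq_mul]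
    field_simp
  simpa only [this] using h

/-- The cone is closed under enlarging entries on `S` and shrinking entries off `S`. -/
lemma concentratedCone_of_abs_le (hF : Monotone F) {z w : EuclideanSpace ℝ (Fin n)}
    (hz : z ∈ concentratedCone F S) (hS : ∀ i ∈ S, |z i| ≤ |w i|)
    (hSc : ∀ i ∉ S, |w i| ≤ |z i|) : w ∈ concentratedCone F S := by
  obtain ⟨t, ht, h⟩ := hz
  refine ⟨t, ht, ?_⟩
  have key {x y : ℝ} (hxy : |x| ≤ |y|) : F (Real.nnabs (t * x)) ≤ F (Real.nnabs (t * y)) := by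
    apply hF
    rw [← NNReal.coe_le_coe]
    simp only [Real.coe_nnabs, abs_mul]
    gcongr
  calc _ ≤ ∑ i ∈ Sᶜ, F (Real.nnabs (t * z i)) :=
        Finset.sum_le_sum fun i hi => key (hSc i (by simpa using hi))
    _ ≤ _ := h
    _ ≤ _ := Finset.sum_le_sum fun i hi => key (hS i hi)

lemma kernelMeetsClosure_of_mem {A : Matrix (Fin m) (Fin n) ℝ} {z : EuclideanSpace ℝ (Fin n)}
    (hz : z ∈ closure (concentratedCone F S)) (h0 : z ≠ 0) (hA : A.toEuclideanLin z = 0) :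
    A ∈ kernelMeetsClosure m F S := by
  have hpos : 0 < ‖z‖ := norm_pos_iff.2 h0
  refine ⟨‖z‖⁻¹ • z, ?_, ?_, by rw [map_smul, hA, smul_zero]⟩
  · exact map_mem_closure (continuous_const_smul _) hz
      fun w hw => smul_mem_concentratedCone hw (inv_pos.2 hpos)
  · rw [norm_smul, norm_inv, norm_norm, inv_mul_cancel₀ hpos.ne']

/-- A vector that costs no more than an `S`-supported one differs from it by an element of the
cone. -/
lemma sub_mem_concentratedCone (hF : IsSparsenessMeasure F) {x y : EuclideanSpace ℝ (Fin n)}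
    (hx : ∀ i ∉ S, x i = 0) (h : cost F y ≤ cost F x) : y - x ∈ concentratedCone F S := by
  refine ⟨1, one_pos, ?_⟩
  simp only [one_mul, PiLp.sub_apply]
  have hF0 : F 0 = 0 := (hF.eq_zero_iff 0).2 rfl
  have h1 : cost F x = ∑ i ∈ S, F (Real.nnabs (x i)) := by
    refine (Finset.sum_subset (Finset.subset_univ S) fun i _ hi => ?_).symm
    simp [hx i hi, hF0]
  have h2 : cost F y = ∑ i ∈ S, F (Real.nnabs (y i)) + ∑ i ∈ Sᶜ, F (Real.nnabs (y i)) :=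
    (Finset.sum_add_sum_compl S _).symm
  have h3 : ∑ i ∈ S, F (Real.nnabs (x i)) ≤
      ∑ i ∈ S, F (Real.nnabs (y i)) + ∑ i ∈ S, F (Real.nnabs (y i - x i)) := by
    rw [← Finset.sum_add_distrib]
    refine Finset.sum_le_sum fun i _ => ?_
    have := hF.subadditive (y i) (x i - y i)
    rw [add_sub_cancel] at this
    have hn : Real.nnabs (x i - y i) = Real.nnabs (y i - x i) := by
      ext; simp [abs_sub_comm]
    rwa [hn] at this
  have h4 : ∑ i ∈ Sᶜ, F (Real.nnabs (y i - x i)) = ∑ i ∈ Sᶜ, F (Real.nnabs (y i)) :=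
    Finset.sum_congr rfl fun i hi => by rw [hx i (by simpa using hi), sub_zero]
  rw [h4]
  rw [h1, h2] at h
  exact le_of_add_le_add_left (h.trans h3)

lemma exists_support_of_isSparse {x : EuclideanSpace ℝ (Fin n)} (hx : IsSparse k x) :
    ∃ S : Finset (Fin n), S.card ≤ k ∧ ∀ i ∉ S, x i = 0 := by
  classical
  refine ⟨Finset.univ.filter fun i => x i ≠ 0, ?_, fun i hi => by simpa using hi⟩
  rw [IsSparse, Set.ncard_eq_toFinset_card'] at hx
  simpa using hx

lemma erc_of_forall_notMem (hF : IsSparsenessMeasure F) {A : Matrix (Fin m) (Fin n) ℝ}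
    (hA : ∀ S : Finset (Fin n), S.card ≤ k → A ∉ kernelMeetsClosure m F S) : ERC F k A := by
  intro xbar hsp x
  obtain ⟨S, hS, hsupp⟩ := exists_support_of_isSparse hsp
  have key (y : EuclideanSpace ℝ (Fin n)) (hy : A.toEuclideanLin y = A.toEuclideanLin xbar)
      (hc : cost F y ≤ cost F xbar) : y = xbar := by
    by_contra hne
    exact hA S hS (kernelMeetsClosure_of_mem
      (subset_closure (sub_mem_concentratedCone hF hsupp hc)) (sub_ne_zero.2 hne)
      (by rw [map_sub, hy, sub_self]))
  refine ⟨fun h => key x h.1 (h.2 xbar rfl), ?_⟩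
  rintro rfl
  refine ⟨rfl, fun y hy => ?_⟩
  by_contra! hlt
  rw [key y hy hlt.le] at hlt
  exact lt_irrefl _ hlt

lemma exists_lower_bound {A : Matrix (Fin m) (Fin n) ℝ} (hA : A ∉ kernelMeetsClosure m F S) :
    ∃ c : ℝ, 0 < c ∧ ∀ z ∈ concentratedCone F S, c * ‖z‖ ≤ ‖A.toEuclideanLin z‖ := by
  have hcomp : IsCompact (closure (concentratedCone F S) ∩ Metric.sphere 0 1) :=
    (isCompact_sphere _ _).inter_left isClosed_closure
  have hcont : Continuous fun z => ‖A.toEuclideanLin z‖ :=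
    (LinearMap.continuous_of_finiteDimensional A.toEuclideanLin).norm
  obtain ⟨c, hc, hle⟩ : ∃ c : ℝ, 0 < c ∧
      ∀ z ∈ closure (concentratedCone F S) ∩ Metric.sphere 0 1, c ≤ ‖A.toEuclideanLin z‖ := by
    rcases (closure (concentratedCone F S) ∩ Metric.sphere 0 1).eq_empty_or_nonempty with he | hne
    · exact ⟨1, one_pos, by simp [he]⟩
    · obtain ⟨z, hz, hmin⟩ := hcomp.exists_isMinOn hne hcont.continuousOn
      refine ⟨_, norm_pos_iff.2 fun h0 => ?_, fun w hw => hmin hw⟩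
      exact hA ⟨z, hz.1, by simpa using hz.2, h0⟩
  refine ⟨c, hc, fun z hz => ?_⟩
  rcases eq_or_ne z 0 with rfl | h0
  · simp
  have hpos : 0 < ‖z‖ := norm_pos_iff.2 h0
  have := hle (‖z‖⁻¹ • z) ⟨subset_closure (smul_mem_concentratedCone hz (inv_pos.2 hpos)), by
    simp [norm_smul, hpos.ne']⟩
  rw [map_smul, norm_smul, norm_inv, norm_norm] at this
  calc c * ‖z‖ ≤ ‖z‖⁻¹ * ‖A.toEuclideanLin z‖ * ‖z‖ := by gcongr
    _ = _ := by field_simp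

lemma rrc_of_forall_notMem (hF : IsSparsenessMeasure F) {A : Matrix (Fin m) (Fin n) ℝ}
    (hA : ∀ S : Finset (Fin n), S.card ≤ k → A ∉ kernelMeetsClosure m F S) : RRC F k A := by
  have hex (S : Finset (Fin n)) : ∃ c : ℝ, 0 < c ∧ (S.card ≤ k →
      ∀ z ∈ concentratedCone F S, c * ‖z‖ ≤ ‖A.toEuclideanLin z‖) := by
    by_cases hS : S.card ≤ k
    · obtain ⟨c, hc, h⟩ := exists_lower_bound (hA S hS)
      exact ⟨c, hc, fun _ => h⟩
    · exact ⟨1, one_pos, fun h => absurd h hS⟩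
  choose c hc hle using hex
  -- The support of `xbar` is not known in advance; the sum bounds `2 / c S` for every `S`.
  refine ⟨∑ S, 2 / c S, fun xbar xhat v ε hε hsp hv hfeas hcost => ?_⟩
  obtain ⟨S, hS, hsupp⟩ := exists_support_of_isSparse hsp
  have h1 := hle S hS _ (sub_mem_concentratedCone hF hsupp hcost)
  have h2 : ‖A.toEuclideanLin (xhat - xbar)‖ < 2 * ε := by
    have : A.toEuclideanLin (xhat - xbar) =
        (A.toEuclideanLin xhat - (A.toEuclideanLin xbar + v)) + v := by
      rw [map_sub]; abel
    rw [this]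
    linarith [norm_add_le (A.toEuclideanLin xhat - (A.toEuclideanLin xbar + v)) v]
  rw [norm_sub_rev]
  have hcS := hc S
  calc ‖xhat - xbar‖ < 2 / c S * ε := by
        rw [div_mul_eq_mul_div, lt_div_iff₀ hcS]
        linarith
    _ ≤ (∑ S, 2 / c S) * ε := by
        gcongr
        exact Finset.single_le_sum (f := fun S => 2 / c S)
          (fun S _ => div_nonneg zero_le_two (hc S).le) (Finset.mem_univ S)

/-- A kernel vector in the cone yields a sparse vector together with a different feasible vector
of no larger cost. -/
lemma exists_competitor (hF : IsSparsenessMeasure F) {A : Matrix (Fin m) (Fin n) ℝ}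
    (hS : S.card ≤ k) (hA : A ∈ kernelMeets m F S) :
    ∃ x y : EuclideanSpace ℝ (Fin n), IsSparse k x ∧ y ≠ x ∧
      A.toEuclideanLin y = A.toEuclideanLin x ∧ cost F y ≤ cost F x := by
  classical
  obtain ⟨z, ⟨t, ht, hle⟩, h0, hker⟩ := hA
  have hF0 : F 0 = 0 := (hF.eq_zero_iff 0).2 rfl
  -- Split `t • z = y - x` into its part off `S` and minus its part on `S`; the cone inequality then
  -- compares the two costs.
  let x : EuclideanSpace ℝ (Fin n) := WithLp.toLp 2 fun i => if i ∈ S then -(t * z i) else 0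
  let y : EuclideanSpace ℝ (Fin n) := WithLp.toLp 2 fun i => if i ∈ S then 0 else t * z i
  have hyx : y - x = t • z := by
    ext i
    by_cases hi : i ∈ S <;> simp [x, y, hi]
  refine ⟨x, y, ?_, ?_, ?_, ?_⟩
  · refine le_trans ?_ hS
    rw [← Set.ncard_coe_finset]
    refine Set.ncard_le_ncard (fun i hi => ?_) S.finite_toSet
    by_contra hiS
    exact hi (if_neg hiS)
  · rw [← sub_ne_zero, hyx]
    exact smul_ne_zero ht.ne' h0
  · rw [← sub_eq_zero, ← map_sub, hyx, map_smul, hker, smul_zero]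
  · have hx : cost F x = ∑ i ∈ S, F (Real.nnabs (t * z i)) := by
      rw [cost, ← Finset.sum_subset (Finset.subset_univ S) fun i _ hi => by simp [x, hi, hF0]]
      refine Finset.sum_congr rfl fun i hi => ?_
      congr 1
      ext
      simp [x, hi]
    have hy : cost F y = ∑ i ∈ Sᶜ, F (Real.nnabs (t * z i)) := by
      rw [cost, ← Finset.sum_subset (Finset.subset_univ Sᶜ) fun i _ hi => by
        simp [y, Finset.mem_compl.not_left.1 hi, hF0]]
      refine Finset.sum_congr rfl fun i hi => ?_
      simp [y, Finset.mem_compl.1 hi]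
    rw [hx, hy]
    exact hle

lemma ERC.notMem_kernelMeets (hF : IsSparsenessMeasure F) {A : Matrix (Fin m) (Fin n) ℝ}
    (hA : ERC F k A) (hS : S.card ≤ k) : A ∉ kernelMeets m F S := by
  intro h
  obtain ⟨x, y, hx, hne, hxy, hc⟩ := exists_competitor hF hS h
  have hsol := (hA x hx x).2 rfl
  exact hne ((hA x hx y).1 ⟨hxy, fun w hw => hc.trans (hsol.2 w hw)⟩)

/-- The competitor is feasible at `v = 0` for every `ε > 0`, so RRC would force its distance to `x`
below every `C * ε`. -/
lemma RRC.notMem_kernelMeets (hF : IsSparsenessMeasure F) {A : Matrix (Fin m) (Fin n) ℝ}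
    (hA : RRC F k A) (hS : S.card ≤ k) : A ∉ kernelMeets m F S := by
  intro h
  obtain ⟨x, y, hx, hne, hxy, hc⟩ := exists_competitor hF hS h
  obtain ⟨C, hC⟩ := hA
  have hpos : 0 < ‖x - y‖ := norm_pos_iff.2 (sub_ne_zero.2 hne.symm)
  have hlt (ε : ℝ) (hε : 0 < ε) : ‖x - y‖ < C * ε :=
    hC x y 0 ε hε hx (by simpa using hε.le) (by simpa [hxy] using hε) hc
  have hC0 : 0 < C := by simpa using hpos.trans (hlt 1 one_pos)
  have := hlt (‖x - y‖ / C) (by positivity)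
  rw [mul_div_cancel₀ _ hC0.ne'] at this
  exact lt_irrefl _ this

end FMin

/-! ### Absolute continuity for independent entries. -/

namespace MeasureTheory

lemma Measure.AbsolutelyContinuous.pi_fin {n : ℕ} {X : Fin n → Type*}
    [∀ i, MeasurableSpace (X i)] {μ ν : ∀ i, Measure (X i)} [∀ i, SigmaFinite (μ i)]
    [∀ i, SigmaFinite (ν i)] (h : ∀ i, μ i ≪ ν i) : Measure.pi μ ≪ Measure.pi ν := by
  induction n with
  | zero => rw [Measure.pi_of_empty μ, Measure.pi_of_empty ν]
  | succ n ih =>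
    have hμ := (measurePreserving_piFinSuccAbove μ 0).symm
    have hν := (measurePreserving_piFinSuccAbove ν 0).symm
    rw [← hμ.map_eq, ← hν.map_eq]
    exact ((h 0).prod (ih fun i => h _)).map (MeasurableEquiv.measurable _)

end MeasureTheory

namespace FMin

/-- A random matrix with independent entries with absolutely continuous laws has an absolutely
continuous law. -/
lemma map_absolutelyContinuous_of_iIndepFun {Ω : Type*} [MeasurableSpace Ω] {P : Measure Ω}
    [IsProbabilityMeasure P] {m n : ℕ} {A : Ω → Fin m → Fin n → ℝ} (hA : Measurable A)
    (hind : iIndepFun (fun (p : Fin m × Fin n) (ω : Ω) => A ω p.1 p.2) P)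
    (hac : ∀ i j, P.map (fun ω => A ω i j) ≪ volume) : P.map A ≪ volume := by
  have hmeas (i : Fin m) (j : Fin n) : Measurable fun ω => A ω i j := by fun_prop
  have (i : Fin m) (j : Fin n) : IsProbabilityMeasure (P.map fun ω => A ω i j) :=
    Measure.isProbabilityMeasure_map (hmeas i j).aemeasurable
  have hlaw : P.map A = Measure.pi fun i => Measure.pi fun j => P.map fun ω => A ω i j := by
    have h1 := (iIndepFun_iff_map_fun_eq_pi_map
      (fun p : Fin m × Fin n => (hmeas p.1 p.2).aemeasurable)).1 hind
    have h2 : P.map A = (P.map fun ω (p : Fin m × Fin n) => A ω p.1 p.2).map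
        (MeasurableEquiv.curry (Fin m) (Fin n) ℝ) := by
      rw [Measure.map_map (MeasurableEquiv.measurable _)
        (measurable_pi_lambda _ fun p : Fin m × Fin n => hmeas p.1 p.2)]
      rfl
    rw [h2, h1, ← Measure.infinitePi_eq_pi,
      Measure.infinitePi_map_curry fun i j => P.map fun ω => A ω i j, Measure.infinitePi_eq_pi]
    simp only [Measure.infinitePi_eq_pi]
  rw [hlaw]
  exact Measure.AbsolutelyContinuous.pi_fin fun i => Measure.AbsolutelyContinuous.pi_fin (hac i)

/-! ### General position of almost every matrix. -/

lemma ae_det_submatrix_ne_zero {m n r : ℕ} {e : Fin r → Fin m} {f : Fin r → Fin n}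
    (he : Function.Injective e) (hf : Function.Injective f) :
    ∀ᵐ A : Fin m → Fin n → ℝ, ((Matrix.of A).submatrix e f).det ≠ 0 := by
  classical
  let M : Fin m → Fin n → ℝ := fun i j => if ∃ l, e l = i ∧ f l = j then 1 else 0
  have hM : (Matrix.of M).submatrix e f = 1 := by
    ext a b
    by_cases hab : a = b
    · subst hab
      simpa [M] using ⟨a, rfl, rfl⟩
    · have : ¬ ∃ l, e l = e a ∧ f l = f b := by
        rintro ⟨l, h1, h2⟩
        exact hab ((he h1).symm.trans (hf h2))
      simp [M, hab, this]
  let L : ℝ →ₗ[ℝ] (Fin m → Fin n → ℝ) := LinearMap.toSpanSingleton ℝ _ M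
  have hopen : IsOpen {A : Fin m → Fin n → ℝ | ((Matrix.of A).submatrix e f).det ≠ 0} := by
    refine isOpen_ne_fun (Continuous.matrix_det ?_) continuous_const
    refine continuous_matrix fun i j => ?_
    simp only [Matrix.submatrix_apply, Matrix.of_apply]
    fun_prop
  -- Fubini along lines of direction `M`: on each, the minor is `det (B + t • 1)`, the
  -- characteristic polynomial of `-B`, with finitely many roots.
  refine ae_mem_of_ae_add_linearMap_mem L volume volume hopen.measurableSet fun A => ?_
  let B := (Matrix.of A).submatrix e f
  have hfin : {t : ℝ | (-B).charpoly.IsRoot t}.Finite :=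
    Polynomial.finite_setOfPred_isRoot (Matrix.charpoly_monic _).ne_zero
  filter_upwards [hfin.measure_zero volume |> compl_mem_ae_iff.2] with t ht h0
  refine ht ?_
  simp only [Set.mem_ofPred_eq, Polynomial.IsRoot, Matrix.eval_charpoly]
  rw [← h0]
  congr 1
  have : (Matrix.of (A + L t)).submatrix e f = B + t • (Matrix.of M).submatrix e f := by
    ext a b; simp [L, B]
  rw [this, hM]
  ext a b
  simp [Matrix.scalar_apply, Matrix.smul_apply, Matrix.one_apply, Matrix.diagonal_apply, add_comm]

/-- Every set of columns of the matrix is linearly independent or spans the target. -/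
def HasFullRankColumns {m n : ℕ} (A : Matrix (Fin m) (Fin n) ℝ) : Prop :=
  ∀ T : Finset (Fin n),
    (∀ z : Fin n → ℝ, (∀ i ∉ T, z i = 0) → A.mulVec z = 0 → z = 0) ∨
    ∀ y : Fin m → ℝ, ∃ z : Fin n → ℝ, (∀ i ∉ T, z i = 0) ∧ A.mulVec z = y

lemma ae_hasFullRankColumns (m n : ℕ) :
    ∀ᵐ A : Fin m → Fin n → ℝ, HasFullRankColumns (Matrix.of A) := by
  have hminor : ∀ᵐ A : Fin m → Fin n → ℝ, ∀ r : Fin (m + 1), ∀ (e : Fin r ↪ Fin m)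
      (f : Fin r ↪ Fin n), ((Matrix.of A).submatrix e f).det ≠ 0 := by
    simp only [ae_all_iff]
    exact fun r e f => ae_det_submatrix_ne_zero e.injective f.injective
  filter_upwards [hminor] with A hA T
  rcases le_total T.card m with hT | hT
  · left
    intro z hz hker
    let f := (T.orderEmbOfFin rfl).toEmbedding
    have hdet := hA ⟨T.card, by omega⟩ (Fin.castLEEmb hT) f
    have hrange (i : Fin n) (hi : i ∉ Set.range f) : z i = 0 :=
      hz i fun h => hi (by simpa [f] using h)
    have h0 : ((Matrix.of A).submatrix (Fin.castLEEmb hT) f).mulVec (z ∘ f) = 0 := by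
      ext a
      have := congrFun hker (Fin.castLEEmb hT a)
      simp only [Matrix.mulVec, dotProduct, Matrix.submatrix_apply, Function.comp_apply,
        Pi.zero_apply] at this ⊢
      rw [← this]
      exact Fintype.sum_of_injective f f.injective _ _
        (fun i hi => by rw [hrange i hi, mul_zero]) fun i => rfl
    have h1 := Matrix.eq_zero_of_mulVec_eq_zero hdet h0
    ext i
    by_cases hi : i ∈ Set.range f
    · obtain ⟨l, rfl⟩ := hi
      exact congrFun h1 l
    · exact hrange i hi
  · right
    intro y
    obtain ⟨T', hT', hcard⟩ := Finset.exists_subset_card_eq hT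
    let f := (T'.orderEmbOfFin hcard).toEmbedding
    have hdet := hA ⟨m, by omega⟩ (Function.Embedding.refl _) f
    let B := (Matrix.of A).submatrix (Function.Embedding.refl (Fin m)) f
    have hB : IsUnit B.det := isUnit_iff_ne_zero.2 hdet
    have hf0 (i : Fin n) (hi : i ∉ Set.range f) :
        Function.extend f (B⁻¹.mulVec y) 0 i = 0 := Function.extend_apply' _ _ _ hi
    refine ⟨Function.extend f (B⁻¹.mulVec y) 0, fun i hi => hf0 i ?_, ?_⟩
    · rintro ⟨l, rfl⟩
      exact hi (hT' (T'.orderEmbOfFin_mem hcard l))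
    · have : B.mulVec (B⁻¹.mulVec y) = y := by
        rw [Matrix.mulVec_mulVec, Matrix.mul_nonsing_inv _ hB, Matrix.one_mulVec]
      refine Eq.trans ?_ this
      ext a
      refine (Fintype.sum_of_injective f f.injective _ _
        (fun i hi => by rw [hf0 i hi, mul_zero]) fun l => ?_).symm
      rw [f.injective.extend_apply]
      rfl

end FMin

/-! ### The column-scaling flow. -/

namespace FMin

open Filter Topology

variable {m n k : ℕ} {F : ℝ≥0 → ℝ≥0} {S : Finset (Fin n)}

/-- The factor of the column `j` under the scaling flow. -/
noncomputable def columnFactor (S : Finset (Fin n)) (t : ℝ) (j : Fin n) : ℝ :=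
  Real.exp (if j ∈ S then -t else t)

/-- The flow on matrices that shrinks the columns in `S` and expands the others. -/
noncomputable def columnFlow (m : ℕ) (S : Finset (Fin n)) (t : ℝ) :
    (Fin m → Fin n → ℝ) →ₗ[ℝ] (Fin m → Fin n → ℝ) where
  toFun A i j := A i j * columnFactor S t j
  map_add' A B := by ext; simp [add_mul]
  map_smul' c A := by ext; simp [mul_assoc]

lemma columnFactor_pos (t : ℝ) (j : Fin n) : 0 < columnFactor S t j := Real.exp_pos _

lemma columnFactor_add (s t : ℝ) (j : Fin n) :
    columnFactor S (s + t) j = columnFactor S s j * columnFactor S t j := by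
  unfold columnFactor
  rw [← Real.exp_add]
  split_ifs
  · rw [neg_add]
  · rfl

lemma columnFlow_columnFlow (s t : ℝ) (A : Fin m → Fin n → ℝ) :
    columnFlow m S s (columnFlow m S t A) = columnFlow m S (s + t) A := by
  ext i j
  simp [columnFlow, columnFactor_add, mul_assoc, mul_comm (columnFactor S s j)]

lemma columnFlow_zero (A : Fin m → Fin n → ℝ) : columnFlow m S 0 A = A := by
  ext i j
  simp [columnFlow, columnFactor]

/-- The scaling of vectors that corresponds to the scaling of columns. -/
noncomputable def scaleVec (S : Finset (Fin n)) (t : ℝ) (z : EuclideanSpace ℝ (Fin n)) :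
    EuclideanSpace ℝ (Fin n) :=
  WithLp.toLp 2 fun j => columnFactor S t j * z j

lemma continuous_scaleVec (t : ℝ) : Continuous (scaleVec S t) := by
  unfold scaleVec
  fun_prop

lemma scaleVec_ne_zero {z : EuclideanSpace ℝ (Fin n)} (hz : z ≠ 0) (t : ℝ) :
    scaleVec S t z ≠ 0 := by
  contrapose! hz
  ext j
  have := congrArg (fun w : EuclideanSpace ℝ (Fin n) => w j) hz
  simpa [scaleVec, (columnFactor_pos t j).ne'] using this

lemma toEuclideanLin_columnFlow (A : Fin m → Fin n → ℝ) (t : ℝ) (z : EuclideanSpace ℝ (Fin n)) :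
    (Matrix.of (columnFlow m S t A)).toEuclideanLin z =
      (Matrix.of A).toEuclideanLin (scaleVec S t z) := by
  ext i
  simp [Matrix.mulVec, dotProduct, columnFlow, scaleVec, mul_assoc]

lemma abs_scaleVec_of_mem (t : ℝ) (z : EuclideanSpace ℝ (Fin n)) {j : Fin n} (hj : j ∈ S) :
    |scaleVec S t z j| = Real.exp (-t) * |z j| := by
  simp [scaleVec, columnFactor, hj, abs_mul]

lemma abs_scaleVec_of_notMem (t : ℝ) (z : EuclideanSpace ℝ (Fin n)) {j : Fin n} (hj : j ∉ S) :
    |scaleVec S t z j| = Real.exp t * |z j| := by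
  simp [scaleVec, columnFactor, hj, abs_mul]

lemma scaleVec_mem_closure (hF : Monotone F) {t : ℝ} (ht : t ≤ 0)
    {z : EuclideanSpace ℝ (Fin n)} (hz : z ∈ closure (concentratedCone F S)) :
    scaleVec S t z ∈ closure (concentratedCone F S) := by
  refine map_mem_closure (continuous_scaleVec t) hz fun w hw =>
    concentratedCone_of_abs_le hF hw (fun i hi => ?_) fun i hi => ?_
  · rw [abs_scaleVec_of_mem t w hi]
    exact le_mul_of_one_le_left (abs_nonneg _) (Real.one_le_exp (by linarith))
  · rw [abs_scaleVec_of_notMem t w hi]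
    exact mul_le_of_le_one_left (abs_nonneg _) (Real.exp_le_one_iff.2 ht)

/-- The matrices whose kernel meets the closed cone are stable under the forward flow. -/
lemma columnFlow_mem_kernelMeetsClosure (hF : Monotone F) {A : Fin m → Fin n → ℝ} {t : ℝ}
    (ht : 0 ≤ t) (hA : Matrix.of A ∈ kernelMeetsClosure m F S) :
    Matrix.of (columnFlow m S t A) ∈ kernelMeetsClosure m F S := by
  obtain ⟨z, hz, h1, hker⟩ := hA
  have h0 : z ≠ 0 := by
    rintro rfl
    simp at h1
  refine kernelMeetsClosure_of_mem (scaleVec_mem_closure hF (neg_nonpos.2 ht) hz)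
    (scaleVec_ne_zero h0 (-t)) ?_
  rw [← toEuclideanLin_columnFlow, columnFlow_columnFlow, neg_add_cancel,
    columnFlow_zero]
  exact hker

/-- For a matrix in general position, the flow moves a kernel vector in the closed cone into the
cone itself. -/
lemma HasFullRankColumns.mem_kernelMeets (hF : Monotone F) {A : Fin m → Fin n → ℝ}
    (hgen : HasFullRankColumns (Matrix.of A)) {t : ℝ} (ht : 0 < t)
    (hA : Matrix.of (columnFlow m S (-t) A) ∈ kernelMeetsClosure m F S) :
    Matrix.of A ∈ kernelMeets m F S := by
  classical
  obtain ⟨z, hz, h1, hker⟩ := hA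
  have h0 : z ≠ 0 := by
    rintro rfl
    simp at h1
  rw [toEuclideanLin_columnFlow] at hker
  set y := scaleVec S (-t) z with hy
  have hy0 : y ≠ 0 := scaleVec_ne_zero h0 _
  have hyz (i : Fin n) : y i = 0 ↔ z i = 0 := by
    simp [hy, scaleVec, (columnFactor_pos _ _).ne']
  let T : Finset (Fin n) := Finset.univ.filter fun i => z i ≠ 0
  obtain ⟨u, hu1, hu0, huker⟩ : ∃ u : EuclideanSpace ℝ (Fin n),
      (∀ i ∈ S, z i = 0 → u i = 1) ∧ (∀ i ∉ S, z i = 0 → u i = 0) ∧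
      (Matrix.of A).toEuclideanLin u = 0 := by
    -- The kernel vector `y ≠ 0` is supported on `T`, so these columns are dependent and hence span;
    -- `x` on `T` cancels the image of `e`.
    rcases hgen T with h | h
    · refine absurd (h y.ofLp (fun i hi => (hyz i).2 (by simpa [T] using hi)) ?_) ?_
      · simpa [Matrix.toLpLin_apply] using hker
      · simpa using hy0
    · let e : Fin n → ℝ := fun i => if i ∈ S ∧ z i = 0 then 1 else 0
      obtain ⟨x, hx, hxe⟩ := h (-(Matrix.of A).mulVec e)
      have hxz (i : Fin n) (hi : z i = 0) : x i = 0 := hx i (by simpa [T] using hi)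
      refine ⟨WithLp.toLp 2 (x + e), fun i hi hzi => ?_, fun i hi hzi => ?_, ?_⟩
      · simp [e, hi, hzi, hxz i hzi]
      · simp [e, hi, hxz i hzi]
      · simp [Matrix.toLpLin_apply, Matrix.mulVec_add, hxe]
  have hlim (i : Fin n) : Tendsto (fun δ : ℝ => |(y + δ • u) i|) (𝓝[>] 0) (𝓝 |y i|) := by
    have : Continuous fun δ : ℝ => |(y + δ • u) i| := by
      simp only [PiLp.add_apply, PiLp.smul_apply]
      fun_prop
    simpa using (this.tendsto 0).mono_left nhdsWithin_le_nhds
  -- Where `z` vanishes on `S`, scaling gains nothing; there the entry `δ` of `δ • u` gives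
  -- strictness.
  have hS : ∀ᶠ δ : ℝ in 𝓝[>] 0, ∀ i, i ∈ S → |z i| < |(y + δ • u) i| := by
    rw [eventually_all]
    intro i
    by_cases hi : i ∈ S
    · by_cases hzi : z i = 0
      · filter_upwards [self_mem_nhdsWithin] with δ hδ _
        have hδ' : (0 : ℝ) < δ := hδ
        simpa [(hyz i).2 hzi, hu1 i hi hzi, hzi] using hδ'.ne'
      · have : |z i| < |y i| := by
          rw [hy, abs_scaleVec_of_mem _ _ hi]
          exact lt_mul_of_one_lt_left (abs_pos.2 hzi) (Real.one_lt_exp_iff.2 (by linarith))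
        filter_upwards [(hlim i).eventually_const_lt this] with δ hδ _ using hδ
    · exact Eventually.of_forall fun δ h => absurd h hi
  have hSc : ∀ᶠ δ : ℝ in 𝓝[>] 0, ∀ i, i ∉ S → z i ≠ 0 → |(y + δ • u) i| < |z i| := by
    rw [eventually_all]
    intro i
    by_cases hi : i ∉ S ∧ z i ≠ 0
    · have : |y i| < |z i| := by
        rw [hy, abs_scaleVec_of_notMem _ _ hi.1]
        exact mul_lt_of_lt_one_left (abs_pos.2 hi.2) (Real.exp_lt_one_iff.2 (by linarith))
      filter_upwards [(hlim i).eventually_lt_const this] with δ hδ _ _ using hδ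
    · exact Eventually.of_forall fun δ h h' => absurd ⟨h, h'⟩ hi
  have hne : ∀ᶠ δ : ℝ in 𝓝[>] 0, y + δ • u ≠ 0 := by
    have : Continuous fun δ : ℝ => y + δ • u := by fun_prop
    have h : Tendsto (fun δ : ℝ => y + δ • u) (𝓝[>] 0) (𝓝 y) := by
      simpa using (this.tendsto 0).mono_left nhdsWithin_le_nhds
    exact h.eventually_ne hy0
  obtain ⟨δ, hδS, hδSc, hδ0⟩ := (hS.and (hSc.and hne)).exists
  set w := y + δ • u with hw
  -- The strict inequalities survive replacing `z` by a nearby point `b` of the cone itself.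
  have hnear : ∀ᶠ b in 𝓝 z, ∀ i, (i ∈ S → |b i| < |w i|) ∧ (i ∉ S → z i ≠ 0 → |w i| < |b i|) := by
    rw [eventually_all]
    intro i
    have hc : Tendsto (fun b : EuclideanSpace ℝ (Fin n) => |b i|) (𝓝 z) (𝓝 |z i|) :=
      Continuous.tendsto (by fun_prop) z
    rw [eventually_and]
    constructor
    · by_cases hi : i ∈ S
      · filter_upwards [hc.eventually_lt_const (hδS i hi)] with b hb _ using hb
      · exact Eventually.of_forall fun b h => absurd h hi
    · by_cases hi : i ∉ S ∧ z i ≠ 0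
      · filter_upwards [hc.eventually_const_lt (hδSc i hi.1 hi.2)] with b hb _ _ using hb
      · exact Eventually.of_forall fun b h h' => absurd ⟨h, h'⟩ hi
  obtain ⟨b, hb, hbK⟩ := ((mem_closure_iff_frequently.1 hz).and_eventually hnear).exists
  refine ⟨w, concentratedCone_of_abs_le hF hb (fun i hi => ((hbK i).1 hi).le) fun i hi => ?_,
    hδ0, by rw [hw, map_add, map_smul, hker, huker, smul_zero, add_zero]⟩
  by_cases hzi : z i = 0
  · have : w i = 0 := by simp [hw, (hyz i).2 hzi, hu0 i hi hzi]
    simp [this]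
  · exact ((hbK i).2 hi hzi).le

/-- Projection along a compact factor is a closed map. -/
lemma isClosed_kernelMeetsClosure (m : ℕ) (F : ℝ≥0 → ℝ≥0) (S : Finset (Fin n)) :
    IsClosed {A : Fin m → Fin n → ℝ | Matrix.of A ∈ kernelMeetsClosure m F S} := by
  let X := (closure (concentratedCone F S) ∩ Metric.sphere 0 1 : Set (EuclideanSpace ℝ (Fin n)))
  have : CompactSpace X :=
    isCompact_iff_compactSpace.1 ((isCompact_sphere _ _).inter_left isClosed_closure)
  have hcl : IsClosed {p : X × (Fin m → Fin n → ℝ) |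
      ∀ i, ∑ j, p.2 i j * (p.1 : EuclideanSpace ℝ (Fin n)) j = 0} := by
    simp only [Set.ofPred_forall]
    exact isClosed_iInter fun i => isClosed_eq (by fun_prop) continuous_const
  convert isClosedMap_snd_of_compactSpace _ hcl using 1
  ext A
  constructor
  · rintro ⟨z, hz, h1, hker⟩
    refine ⟨⟨⟨z, hz, by simpa using h1⟩, A⟩, fun i => ?_, rfl⟩
    have := congrArg (fun w : EuclideanSpace ℝ (Fin m) => w i) hker
    simpa [Matrix.mulVec, dotProduct] using this
  · rintro ⟨⟨⟨z, hz, h1⟩, B⟩, hker, rfl⟩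
    refine ⟨z, hz, by simpa using h1, ?_⟩
    ext i
    simpa [Matrix.mulVec, dotProduct] using hker i

/-! ### Null exit set and conclusion. -/

/-- Exit points of the backward flow form a null set. -/
lemma volume_exit_eq_zero (hF : Monotone F) (m : ℕ) (S : Finset (Fin n)) :
    volume ({A : Fin m → Fin n → ℝ | Matrix.of A ∈ kernelMeetsClosure m F S} ∩
      ⋂ N : ℕ, columnFlow m S (-(1 / ((N : ℝ) + 1))) ⁻¹'
        {A | Matrix.of A ∈ kernelMeetsClosure m F S}ᶜ) = 0 := by
  have hG := (isClosed_kernelMeetsClosure m F S).measurableSet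
  set G := {A : Fin m → Fin n → ℝ | Matrix.of A ∈ kernelMeetsClosure m F S}
  set E := G ∩ ⋂ N : ℕ, columnFlow m S (-(1 / ((N : ℝ) + 1))) ⁻¹' Gᶜ
  have hcont (t : ℝ) : Continuous (columnFlow m S t) :=
    LinearMap.continuous_of_finiteDimensional _
  have hE : MeasurableSet E := by
    refine hG.inter (MeasurableSet.iInter fun N => ?_)
    exact (hcont (-(1 / ((N : ℝ) + 1)))).measurable hG.compl
  have hout {A : Fin m → Fin n → ℝ} (hA : A ∈ E) {t : ℝ} (ht : 0 < t) :
      columnFlow m S (-t) A ∉ G := by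
    obtain ⟨N, hN⟩ := exists_nat_one_div_lt ht
    intro h
    refine Set.mem_iInter.1 hA.2 N ?_
    rw [show -(1 / ((N : ℝ) + 1)) = (t - 1 / ((N : ℝ) + 1)) + -t by ring,
      ← columnFlow_columnFlow]
    exact columnFlow_mem_kernelMeetsClosure hF (by linarith) h
  let D (t : ℝ) : Set (Fin m → Fin n → ℝ) := columnFlow m S t ⁻¹' E
  have hdisj' {s t : ℝ} (hst : s < t) : Disjoint (D s) (D t) := by
    refine Set.disjoint_left.2 fun A hs ht => hout ht (sub_pos.2 hst) ?_
    rw [columnFlow_columnFlow, show -(t - s) + t = s by ring]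
    exact hs.1
  have hdisj : Pairwise (Function.onFun Disjoint D) := by
    intro s t hst
    rcases lt_or_gt_of_ne hst with h | h
    · exact hdisj' h
    · exact (hdisj' h).symm
  have hcount := Measure.countable_meas_pos_of_disjoint_iUnion (μ := volume)
    (fun t => (hcont t).measurable hE) hdisj
  -- Only countably many disjoint sets can have positive measure, but `t` ranges over all of `ℝ`.
  obtain ⟨t, ht⟩ : ∃ t, t ∉ {t | 0 < volume (D t)} := by
    by_contra! h
    exact Set.not_countable_univ (hcount.mono fun t _ => h t)
  have hD : volume (D t) = 0 := by simpa using ht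
  have hED : E = columnFlow m S t '' D t := by
    refine (Set.image_preimage_eq _ fun A => ⟨columnFlow m S (-t) A, ?_⟩).symm
    rw [columnFlow_columnFlow, add_neg_cancel, columnFlow_zero]
  rw [hED, Measure.addHaar_image_linearMap, hD, mul_zero]

lemma ae_mem_kernelMeets (hF : Monotone F) (m : ℕ) (S : Finset (Fin n)) :
    ∀ᵐ A : Fin m → Fin n → ℝ, Matrix.of A ∈ kernelMeetsClosure m F S →
      Matrix.of A ∈ kernelMeets m F S := by
  filter_upwards [ae_hasFullRankColumns m n,
    compl_mem_ae_iff.2 (volume_exit_eq_zero hF m S)] with A hgen hE hA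
  simp only [Set.mem_compl_iff, Set.mem_inter_iff, Set.mem_iInter, Set.mem_preimage,
    Set.mem_ofPred_eq, not_and, not_forall, not_not] at hE
  obtain ⟨N, hN⟩ := hE hA
  exact hgen.mem_kernelMeets hF (by positivity) hN

/-- Almost every matrix satisfies each recovery condition exactly when its kernel avoids the
closed cones. -/
lemma ae_recovery_iff (hF : IsSparsenessMeasure F) (hmono : Monotone F) (m n k : ℕ) :
    ∀ᵐ A : Fin m → Fin n → ℝ,
      (ERC F k (Matrix.of A) ↔ ∀ S : Finset (Fin n), S.card ≤ k →
        Matrix.of A ∉ kernelMeetsClosure m F S) ∧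
      (RRC F k (Matrix.of A) ↔ ∀ S : Finset (Fin n), S.card ≤ k →
        Matrix.of A ∉ kernelMeetsClosure m F S) := by
  filter_upwards [ae_all_iff.2 fun S : Finset (Fin n) => ae_mem_kernelMeets hmono m S] with A hA
  exact ⟨⟨fun h S hS hmem => h.notMem_kernelMeets hF hS (hA S hmem), erc_of_forall_notMem hF⟩,
    ⟨fun h S hS hmem => h.notMem_kernelMeets hF hS (hA S hmem), rrc_of_forall_notMem hF⟩⟩

lemma sameProbability_of_absolutelyContinuous {Ω : Type*} [MeasurableSpace Ω] {P : Measure Ω}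
    (hF : IsSparsenessMeasure F) (hmono : Monotone F) (k : ℕ) {A : Ω → Matrix (Fin m) (Fin n) ℝ}
    (hA : Measurable A) (hac : P.map A ≪ volume) : SameProbability P F k A := by
  let U : Set (Fin m → Fin n → ℝ) := {A | ∀ S : Finset (Fin n), S.card ≤ k →
    Matrix.of A ∉ kernelMeetsClosure m F S}
  have hU : MeasurableSet U := by
    simp only [U, Set.ofPred_forall]
    exact MeasurableSet.iInter fun S => MeasurableSet.iInter fun _ =>
      (isClosed_kernelMeetsClosure m F S).measurableSet.compl
  have hq : Measure.QuasiMeasurePreserving (fun ω => (A ω : Fin m → Fin n → ℝ)) P volume :=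
    ⟨hA, hac⟩
  have hae := hq.ae (ae_recovery_iff hF hmono m n k)
  have hUm : MeasurableSet {ω | (A ω : Fin m → Fin n → ℝ) ∈ U} := hA hU
  have hE : {ω | ERC F k (A ω)} =ᵐ[P] {ω | (A ω : Fin m → Fin n → ℝ) ∈ U} := by
    filter_upwards [hae] with ω hω using propext hω.1
  have hR : {ω | RRC F k (A ω)} =ᵐ[P] {ω | (A ω : Fin m → Fin n → ℝ) ∈ U} := by
    filter_upwards [hae] with ω hω using propext hω.2
  exact ⟨hUm.nullMeasurableSet.congr hE.symm, hUm.nullMeasurableSet.congr hR.symm,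
    measure_congr (hE.trans hR.symm)⟩

end FMin

theorem corollary3 {Ω : Type*} [MeasurableSpace Ω] (P : Measure Ω) [IsProbabilityMeasure P]
    (m n k : ℕ) (F : ℝ≥0 → ℝ≥0) (hF : FMin.IsSparsenessMeasure F) (hmono : Monotone F)
    (A : Ω → Matrix (Fin m) (Fin n) ℝ) (hA : Measurable A) :
    (P.map A ≪ volume → FMin.SameProbability P F k A) ∧
    (∀ ρ : Measure ℝ, ρ ≪ volume →
      iIndepFun (fun (p : Fin m × Fin n) (ω : Ω) => A ω p.1 p.2) P →
      (∀ i j, P.map (fun ω => A ω i j) = ρ) →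
      FMin.SameProbability P F k A) := by
  refine ⟨FMin.sameProbability_of_absolutelyContinuous hF hmono k hA, fun ρ hρ hind hlaw => ?_⟩
  refine FMin.sameProbability_of_absolutelyContinuous hF hmono k hA ?_
  exact FMin.map_absolutelyContinuous_of_iIndepFun (A := fun ω => (A ω : Fin m → Fin n → ℝ)) hA
    hind fun i j => (hlaw i j).symm ▸ hρ
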